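/- Let $M$ be a compact smooth (Hausdorff, finite-dimensional, boundaryless) manifold endowed with a globally defined two-contact form, i.e. a smooth one-form $\boldsymbol\eta\in\Omega^1(M,\mathbb{R}^2)$ such that 1. $\ker\boldsymbol\eta\subset \mathrm{T}M$ is a regular (smooth, constant rank) non-zero distribution of corank $2$, 2. $\ker \mathrm{d}\boldsymbol\eta=\{v\in \mathrm{T}M : \iota_v\mathrm{d}\boldsymbol\eta=0\}$ is a regular distribution of rank $2$, 3. $\ker\boldsymbol\eta\cap\ker \mathrm{d}\boldsymbol\eta=0$. (So $(M,\boldsymbol\eta)$ is a compact co-oriented two-contact manifold, and $\ker\mathrm{d}\boldsymbol\eta$ is its Reeb distribution.) Let $\iota\colon N\to M$ be a connected integral submanifold of the Reeb distribution: $N$ is a connected smooth manifold, $\iota$ is an injective smooth immersion, and $\mathrm{T}_q\iota(\mathrm{T}_qN)=(\ker\mathrm{d}\boldsymbol\eta)_{\iota(q)}$ for every $q\in N$. If $N$ is closed, i.e. $\iota(N)$ is a closed subset of $M$, then $N$ is homeomorphic to the two-dimensional torus $\mathbb{T}^2=S^1\times S^1$. -/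

import Mathlib

open scoped Manifold ContDiff Bundle

noncomputable section

namespace KContact

/-! Throughout, `M` is a smooth manifold without boundary of dimension `m`, given by a
`ChartedSpace (EuclideanSpace ℝ (Fin m)) M` structure with `IsManifold (𝓡 m) ∞ M`. -/

section

variable {m : ℕ} {M : Type*} [TopologicalSpace M] [ChartedSpace (EuclideanSpace ℝ (Fin m)) M]
  [IsManifold (𝓡 m) ∞ M]

/-- A (generalised) distribution on `M`: a linear subspace of each tangent space. -/
abbrev Distribution (m : ℕ) (M : Type*) [TopologicalSpace M]
    [ChartedSpace (EuclideanSpace ℝ (Fin m)) M] : Type _ :=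
  ∀ x : M, Submodule ℝ (TangentSpace (𝓡 m) x)

/-- A distribution is smooth if around every point it is spanned by finitely many smooth vector
fields (which need not be linearly independent). -/
def Distribution.IsSmooth (D : Distribution m M) : Prop :=
  ∀ x : M, ∃ U : Set M, IsOpen U ∧ x ∈ U ∧
    ∃ (r : ℕ) (X : Fin r → ∀ y : M, TangentSpace (𝓡 m) y),
      (∀ i, ContMDiffOn (𝓡 m) (𝓡 m).tangent ∞
        (fun y => (⟨y, X i y⟩ : TangentBundle (𝓡 m) M)) U) ∧
      ∀ y ∈ U, D y = Submodule.span ℝ (Set.range fun i => X i y)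

/-- A regular distribution of rank `r`. -/
structure Distribution.IsRegularOfRank (D : Distribution m M) (r : ℕ) : Prop where
  isSmooth : D.IsSmooth
  finrank_eq : ∀ x, Module.finrank ℝ (D x) = r

/-- A regular distribution of corank `r`: smooth, and of codimension `r` in every tangent space. -/
structure Distribution.IsRegularOfCorank (D : Distribution m M) (r : ℕ) : Prop where
  isSmooth : D.IsSmooth
  finrank_quotient_eq : ∀ x, Module.finrank ℝ (TangentSpace (𝓡 m) x ⧸ D x) = r

end

/-- `Ω¹(M, ℝᵏ)`: smooth differential one-forms on `M` with values in `ℝᵏ`, that is, smooth sections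
of the vector bundle `Hom(TM, M × ℝᵏ)`. -/
abbrev OneForm (m : ℕ) (M : Type*) [TopologicalSpace M]
    [ChartedSpace (EuclideanSpace ℝ (Fin m)) M] [IsManifold (𝓡 m) ∞ M] (k : ℕ) : Type _ :=
  ContMDiffSection (𝓡 m) (EuclideanSpace ℝ (Fin m) →L[ℝ] (Fin k → ℝ)) ∞
    (fun x : M => TangentSpace (𝓡 m) x →L[ℝ] Bundle.Trivial M (Fin k → ℝ) x)

section

variable {m : ℕ} {M : Type*} [TopologicalSpace M] [ChartedSpace (EuclideanSpace ℝ (Fin m)) M]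
  [IsManifold (𝓡 m) ∞ M] {k : ℕ}

/-- The expression of the one-form `η` in the preferred chart `φ` at `x`: the pullback of `η` by
`φ⁻¹`, as a one-form on the model space (meaningful on the target of `φ`). -/
def OneForm.inChart (η : OneForm m M k) (x : M) :
    EuclideanSpace ℝ (Fin m) → EuclideanSpace ℝ (Fin m) →L[ℝ] (Fin k → ℝ) :=
  fun y => (η ((extChartAt (𝓡 m) x).symm y)).comp
    (mfderiv 𝓘(ℝ, EuclideanSpace ℝ (Fin m)) (𝓡 m) (extChartAt (𝓡 m) x).symm y)

/-- The exterior derivative `dη` at `x`, an alternating two-form on `T_xM` with values in `ℝᵏ`: the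
pullback by the preferred chart `φ` at `x` of the exterior derivative, on the model space, of
the pullback of `η` by `φ⁻¹`. -/
def OneForm.d (η : OneForm m M k) (x : M) : TangentSpace (𝓡 m) x [⋀^Fin 2]→L[ℝ] (Fin k → ℝ) :=
  (extDeriv (fun y => ContinuousAlternatingMap.ofSubsingleton ℝ (EuclideanSpace ℝ (Fin m))
      (Fin k → ℝ) (0 : Fin 1) (η.inChart x y)) (extChartAt (𝓡 m) x x)).compContinuousLinearMap
    (mfderiv (𝓡 m) 𝓘(ℝ, EuclideanSpace ℝ (Fin m)) (extChartAt (𝓡 m) x) x)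

/-- The distribution `ker η`. -/
def OneForm.ker (η : OneForm m M k) : Distribution m M :=
  fun x => LinearMap.ker (η x : TangentSpace (𝓡 m) x →ₗ[ℝ] (Fin k → ℝ))

/-- The distribution `ker dη`, whose value at `x` is `{v ∈ T_xM | ι_v (dη)_x = 0}`. -/
def OneForm.kerD (η : OneForm m M k) : Distribution m M :=
  fun x => LinearMap.ker (η.d x).toAlternatingMap.curryLeft

/-- A (globally defined) `k`-contact form on `M`; the pair `(M, η)` is then a co-oriented
`k`-contact manifold. -/
structure OneForm.IsKContact (η : OneForm m M k) : Prop where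
  ker_isRegular : η.ker.IsRegularOfCorank k
  ker_ne_bot : ∀ x, η.ker x ≠ ⊥
  kerD_isRegular : η.kerD.IsRegularOfRank k
  ker_inf_kerD : ∀ x, η.ker x ⊓ η.kerD x = ⊥

/-- The Reeb distribution `ker dη` of a co-oriented `k`-contact manifold `(M, η)`. -/
abbrev OneForm.reebDistribution (η : OneForm m M k) : Distribution m M := η.kerD

end

/-- `ι : N → M` is an (immersed) integral submanifold of the distribution `D` on `M`: an injective
smooth immersion of the manifold `N` such that the tangent space of the
submanifold at each of its points is the whole of the fibre of `D`. -/
structure IsIntegralSubmanifold {m n : ℕ} {M : Type*} [TopologicalSpace M]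
    [ChartedSpace (EuclideanSpace ℝ (Fin m)) M] {N : Type*} [TopologicalSpace N]
    [ChartedSpace (EuclideanSpace ℝ (Fin n)) N] (D : Distribution m M) (ι : N → M) : Prop where
  contMDiff : ContMDiff (𝓡 n) (𝓡 m) ∞ ι
  injective : Function.Injective ι
  injective_mfderiv : ∀ q, Function.Injective (mfderiv (𝓡 n) (𝓡 m) ι q)
  range_mfderiv : ∀ q, LinearMap.range (mfderiv (𝓡 n) (𝓡 m) ι q :
    TangentSpace (𝓡 n) q →ₗ[ℝ] TangentSpace (𝓡 m) (ι q)) = D (ι q)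

end KContact

end

/-!
The two components of a two-contact form restrict to a coframe on each fibre of the Reeb
distribution, so every `v : ℝ²` has a Reeb vector field `R_v`: the section of `ker dη` with
`η (R_v) = v`. It is smooth and depends linearly on `v`, and since `M` is compact it has a global
flow, whose time-one map is `reebFlow v`.

On an integral submanifold `ι : N → M` the pullback `ι^*η` is a coframe, and it is closed because
the tangent spaces of `N` lie in `ker dη` (`OneForm.pullback_closed`). By the Poincaré lemma and the
inverse function theorem `N` has local coordinates in `ℝ²` in which `ι^*η` is the standard coframe,
that is, in which the Reeb flows are translations
(`IsIntegralSubmanifold.exists_reebFlow_coordinates`). In particular the set of times at which a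
Reeb orbit lies in `ι(N)` is open; it is closed when `ι(N)` is. Hence the Reeb flows restrict to
complete flows on `N`. That they form an action of `ℝ²` is not deduced from a bracket
computation on `M`: it holds locally on `N`, where the flows are translations, and spreads along
orbits because a property of real numbers that is locally constant is constant
(`IsLocallyTranslation.add`).

The orbits of this action on `N` are open, so the action is transitive and `N` is a quotient of
`ℝ²` by a discrete subgroup. It remains to see that `N`, whose topology could a priori be finer
than that of `ι(N)`, is compact. As a countable union of images of closed balls of `ℝ²`, the
compact Hausdorff space `ι(N)` contains by Baire's theorem an open piece covered by one of them.
Since the Reeb flows are homeomorphisms of `M` acting transitively on `ι(N)`, finitely many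
translates of that piece cover `N` (`IsLocallyTranslation.compactSpace_of_isClosed_range`). The
isotropy group then spans `ℝ²`, so it is a lattice and `N` is a torus
(`IsLocallyTranslation.nonempty_homeomorph_torus`).
-/

namespace KContact

open Filter Topology Set Metric Module

/-! ### Local translation actions of a vector space -/

/-- A property of real numbers that is locally constant and holds at `0` holds everywhere. -/
lemma forall_real_of_locally_iff {P : ℝ → Prop} (h0 : P 0)
    (h : ∀ t, ∃ ε > 0, ∀ δ, |δ| < ε → (P (t + δ) ↔ P t)) (t : ℝ) : P t := by
  have hclopen : IsClopen {t | P t} := by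
    constructor
    · rw [← isOpen_compl_iff, Metric.isOpen_iff]
      intro t ht
      obtain ⟨ε, hε, H⟩ := h t
      refine ⟨ε, hε, fun s hs => ?_⟩
      have := H (s - t) (by simpa [Real.dist_eq] using hs)
      simp only [add_sub_cancel] at this
      exact fun hP => ht (this.1 hP)
    · rw [Metric.isOpen_iff]
      intro t ht
      obtain ⟨ε, hε, H⟩ := h t
      refine ⟨ε, hε, fun s hs => ?_⟩
      have := H (s - t) (by simpa [Real.dist_eq] using hs)
      simp only [add_sub_cancel] at this
      exact this.2 ht
  have := hclopen.eq_univ ⟨0, h0⟩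
  exact (this.symm ▸ mem_univ t : t ∈ {t | P t})

lemma exists_norm_smul_lt {V : Type*} [NormedAddCommGroup V] [NormedSpace ℝ V] (w : V)
    {r : ℝ} (hr : 0 < r) :
    ∃ ε > 0, ∀ δ : ℝ, |δ| < ε → ‖δ • w‖ < r := by
  have : Tendsto (fun δ : ℝ => ‖δ • w‖) (𝓝 0) (𝓝 0) := by
    have : Continuous (fun δ : ℝ => ‖δ • w‖) := by fun_prop
    simpa using this.tendsto 0
  obtain ⟨ε, hε, h⟩ := Metric.eventually_nhds_iff.1 (this.eventually (gt_mem_nhds hr))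
  exact ⟨ε, hε, fun δ hδ => h (by simpa using hδ)⟩

section

variable {V : Type*} [NormedAddCommGroup V] [NormedSpace ℝ V] {N : Type*} [TopologicalSpace N]

/-- A family `Ψ` of self-maps of `N` indexed by a vector space `V` that restricts to a flow on every
line of `V` and that, around every point of `N`, is intertwined by a local homeomorphism
from a ball of `V` with the translations of `V`. No compatibility between different lines is
required globally. -/
structure IsLocallyTranslation (Ψ : V → N → N) : Prop where
  zero : ∀ q, Ψ 0 q = q
  add_smul : ∀ (v : V) (s t : ℝ) (q : N), Ψ ((s + t) • v) q = Ψ (s • v) (Ψ (t • v) q)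
  exists_chart : ∀ q, ∃ r > 0, ∃ s : V → N, s 0 = q ∧ InjOn s (ball 0 r) ∧
    (∀ p ∈ ball (0 : V) r, map s (𝓝 p) = 𝓝 (s p)) ∧
    ∀ p w, p ∈ ball (0 : V) r → p + w ∈ ball (0 : V) r → Ψ w (s p) = s (p + w)

namespace IsLocallyTranslation

variable {Ψ : V → N → N} (hΨ : IsLocallyTranslation Ψ)
include hΨ

lemma neg_cancel (v : V) (q : N) : Ψ (-v) (Ψ v q) = q := by
  have := hΨ.add_smul v (-1) 1 q
  simpa [hΨ.zero] using this.symm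

lemma injective (v : V) : Function.Injective (Ψ v) :=
  Function.LeftInverse.injective (hΨ.neg_cancel v)

/-- At every point the additivity relation holds for vectors that are small, with a bound that
depends on the point. -/
lemma add_of_small (q : N) :
    ∃ r > 0, ∀ v w : V, ‖v‖ < r → ‖w‖ < r → Ψ v (Ψ w q) = Ψ (v + w) q := by
  obtain ⟨r, hr, s, hs0, -, -, hs⟩ := hΨ.exists_chart q
  refine ⟨r / 2, by positivity, fun v w hv hw => ?_⟩
  have h0 : (0 : V) ∈ ball (0 : V) r := mem_ball_self hr
  have h1 : w ∈ ball (0 : V) r := by rw [mem_ball_zero_iff]; linarith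
  have h2 : w + v ∈ ball (0 : V) r := by
    rw [mem_ball_zero_iff]; linarith [norm_add_le w v]
  have e1 := hs 0 w h0 (by simpa using h1)
  have e2 := hs w v h1 h2
  have e3 := hs 0 (v + w) h0 (by simpa [add_comm] using h2)
  rw [hs0, zero_add] at e1 e3
  rw [e1, e2, e3, add_comm]

lemma commute_of_small (q : N) (w : V) :
    ∃ r > 0, ∀ v : V, ‖v‖ < r → Ψ v (Ψ w q) = Ψ w (Ψ v q) := by
  have key : ∀ t : ℝ, ∃ r > 0, ∀ v : V, ‖v‖ < r →
      Ψ v (Ψ (t • w) q) = Ψ (t • w) (Ψ v q) := by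
    apply forall_real_of_locally_iff
    · exact ⟨1, one_pos, fun v _ => by simp [hΨ.zero]⟩
    intro t
    obtain ⟨ρ, hρ, hadd⟩ := hΨ.add_of_small (Ψ (t • w) q)
    obtain ⟨ε, hε, hsmall⟩ := exists_norm_smul_lt w hρ
    refine ⟨ε, hε, fun δ hδ => ?_⟩
    -- at the point `Ψ (t • w) q` small translations commute, and `Ψ (δ • w)` can be cancelled
    have hiff : ∀ v : V, ‖v‖ < ρ → (Ψ v (Ψ ((t + δ) • w) q) = Ψ ((t + δ) • w) (Ψ v q) ↔
        Ψ v (Ψ (t • w) q) = Ψ (t • w) (Ψ v q)) := by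
      intro v hv
      rw [add_comm t δ, hΨ.add_smul, hΨ.add_smul, hadd v _ hv (hsmall δ hδ), add_comm,
        ← hadd _ v (hsmall δ hδ) hv]
      exact (hΨ.injective _).eq_iff
    constructor
    · rintro ⟨r, hr, h⟩
      exact ⟨min r ρ, lt_min hr hρ, fun v hv =>
        (hiff v (hv.trans_le (min_le_right _ _))).1 (h v (hv.trans_le (min_le_left _ _)))⟩
    · rintro ⟨r, hr, h⟩
      exact ⟨min r ρ, lt_min hr hρ, fun v hv =>
        (hiff v (hv.trans_le (min_le_right _ _))).2 (h v (hv.trans_le (min_le_left _ _)))⟩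
  simpa using key 1

lemma commute (v w : V) (q : N) : Ψ v (Ψ w q) = Ψ w (Ψ v q) := by
  have key : ∀ t : ℝ, Ψ (t • v) (Ψ w q) = Ψ w (Ψ (t • v) q) := by
    apply forall_real_of_locally_iff
    · simp [hΨ.zero]
    intro t
    obtain ⟨ρ, hρ, hcomm⟩ := hΨ.commute_of_small (Ψ (t • v) q) w
    obtain ⟨ε, hε, hsmall⟩ := exists_norm_smul_lt v hρ
    refine ⟨ε, hε, fun δ hδ => ?_⟩
    rw [add_comm t δ, hΨ.add_smul, hΨ.add_smul, ← hcomm _ (hsmall δ hδ)]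
    exact (hΨ.injective _).eq_iff
  simpa using key 1

/-- The maps `Ψ v` form an action of the additive group `V`. -/
lemma add (v w : V) (q : N) : Ψ (v + w) q = Ψ v (Ψ w q) := by
  have key : ∀ t : ℝ, Ψ (t • (v + w)) q = Ψ (t • v) (Ψ (t • w) q) := by
    apply forall_real_of_locally_iff
    · simp [hΨ.zero]
    intro t
    obtain ⟨ρ, hρ, hadd⟩ := hΨ.add_of_small (Ψ (t • (v + w)) q)
    obtain ⟨ε, hε, hsmall⟩ := exists_norm_smul_lt v hρ
    obtain ⟨ε', hε', hsmall'⟩ := exists_norm_smul_lt w hρ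
    refine ⟨min ε ε', lt_min hε hε', fun δ hδ => ?_⟩
    rw [add_comm t δ, hΨ.add_smul, hΨ.add_smul, hΨ.add_smul, smul_add δ,
      ← hadd _ _ (hsmall δ (hδ.trans_le (min_le_left _ _)))
        (hsmall' δ (hδ.trans_le (min_le_right _ _))),
      hΨ.commute (t • v) (δ • w), (hΨ.injective _).eq_iff, (hΨ.injective _).eq_iff]
  simpa using key 1

/-- Orbit maps are local homeomorphisms. -/
lemma map_nhds_orbit (q : N) (p : V) : map (fun v => Ψ v q) (𝓝 p) = 𝓝 (Ψ p q) := by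
  obtain ⟨r, hr, s, hs0, -, hmap, hs⟩ := hΨ.exists_chart (Ψ p q)
  have hev : (fun v => Ψ v q) =ᶠ[𝓝 p] s ∘ fun v => v - p := by
    filter_upwards [ball_mem_nhds p hr] with v hv
    have := hs 0 (v - p) (mem_ball_self hr) (by simpa [dist_eq_norm] using hv)
    rw [hs0, zero_add, ← hΨ.add, sub_add_cancel] at this
    exact this
  have h0 := hmap 0 (mem_ball_self hr)
  rw [Filter.map_congr hev, ← Filter.map_map, ← hs0, ← h0]
  congr 1
  have := (Homeomorph.subRight p).map_nhds_eq p
  simpa only [Homeomorph.coe_subRight, sub_self] using this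

lemma continuous_orbit (q : N) : Continuous fun v => Ψ v q :=
  continuous_iff_continuousAt.2 fun p => (hΨ.map_nhds_orbit q p).le

lemma isOpenMap_orbit (q : N) : IsOpenMap fun v => Ψ v q :=
  isOpenMap_iff_nhds_le.2 fun p => (hΨ.map_nhds_orbit q p).ge

/-- On a connected space the action is transitive, because its orbits are open. -/
lemma surjective_orbit [ConnectedSpace N] (q : N) : Function.Surjective fun v => Ψ v q := by
  have hopen : ∀ q, IsOpen (range fun v => Ψ v q) := fun q => (hΨ.isOpenMap_orbit q).isOpen_range
  have hcl : IsClosed (range fun v => Ψ v q) := by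
    have : (range fun v => Ψ v q)ᶜ = ⋃ q' ∈ (range fun v => Ψ v q)ᶜ, range fun v => Ψ v q' := by
      ext x
      simp only [mem_iUnion, exists_prop]
      constructor
      · exact fun hx => ⟨x, hx, 0, hΨ.zero x⟩
      · rintro ⟨q', hq', w, rfl⟩ ⟨v, hv⟩
        refine hq' ⟨-w + v, ?_⟩
        simp only at hv ⊢
        rw [hΨ.add, hv, hΨ.neg_cancel]
    rw [← isOpen_compl_iff, this]
    exact isOpen_biUnion fun q' _ => hopen q'
  exact range_eq_univ.1 (IsClopen.eq_univ ⟨hcl, hopen q⟩ ⟨_, 0, rfl⟩)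

lemma isOpenQuotientMap_orbit [ConnectedSpace N] (q : N) : IsOpenQuotientMap fun v => Ψ v q :=
  ⟨hΨ.surjective_orbit q, hΨ.continuous_orbit q, hΨ.isOpenMap_orbit q⟩

lemma continuous [ConnectedSpace N] (v : V) : Continuous (Ψ v) := by
  obtain ⟨q⟩ := (inferInstance : Nonempty N)
  rw [(hΨ.isOpenQuotientMap_orbit q).isQuotientMap.continuous_iff]
  have : Ψ v ∘ (fun w => Ψ w q) = fun w => Ψ (v + w) q := funext fun w => (hΨ.add v w q).symm
  rw [this]
  exact (hΨ.continuous_orbit q).comp (by fun_prop)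

/-- The isotropy group of `q`, as a subgroup of `V`. -/
def stabilizer (q : N) : Submodule ℤ V :=
  AddSubgroup.toIntSubmodule
    { carrier := {v | Ψ v q = q}
      add_mem' := fun {a b} ha hb => by
        simp only [mem_ofPred_eq] at ha hb ⊢
        rw [hΨ.add, hb, ha]
      zero_mem' := hΨ.zero q
      neg_mem' := fun {a} ha => by
        simp only [mem_ofPred_eq] at ha ⊢
        conv_lhs => rw [← ha]
        exact hΨ.neg_cancel a q }

lemma mem_stabilizer {q : N} {v : V} : v ∈ hΨ.stabilizer q ↔ Ψ v q = q := Iff.rfl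

lemma orbit_eq_iff {q : N} {v w : V} : Ψ v q = Ψ w q ↔ v - w ∈ hΨ.stabilizer q := by
  rw [hΨ.mem_stabilizer, sub_eq_neg_add, hΨ.add]
  constructor
  · intro h
    rw [h, hΨ.neg_cancel]
  · intro h
    rw [← (hΨ.injective (-w)).eq_iff, h, hΨ.neg_cancel]

lemma discreteTopology_stabilizer (q : N) : DiscreteTopology (hΨ.stabilizer q) := by
  obtain ⟨r, hr, s, hs0, hinj, -, hs⟩ := hΨ.exists_chart q
  refine discreteTopology_of_isOpen_singleton_zero ?_
  have : ({0} : Set (hΨ.stabilizer q)) = Subtype.val ⁻¹' ball (0 : V) r := by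
    ext ⟨v, hv⟩
    simp only [mem_singleton_iff, mem_preimage]
    constructor
    · intro h
      rw [show v = 0 from congrArg Subtype.val h]
      exact mem_ball_self hr
    · intro h
      have e := hs 0 v (mem_ball_self hr) (by simpa using h)
      rw [zero_add, hs0, hΨ.mem_stabilizer.1 hv, ← hs0] at e
      exact Subtype.ext (hinj h (mem_ball_self hr) e.symm)
  rw [this]
  exact isOpen_ball.preimage continuous_subtype_val

/-- If `N` is compact, the isotropy groups span `V`: a linear form vanishing on an isotropy group
descends to a continuous function on `N`, which is bounded. -/
lemma span_stabilizer_eq_top [FiniteDimensional ℝ V] [ConnectedSpace N] [CompactSpace N] (q : N) :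
    Submodule.span ℝ (hΨ.stabilizer q : Set V) = ⊤ := by
  by_contra hne
  obtain ⟨f, hf0, hf⟩ := Submodule.exists_le_ker_of_lt_top _ (lt_top_iff_ne_top.2 hne)
  have hquot := (hΨ.isOpenQuotientMap_orbit q).isQuotientMap
  have hfac : ∀ v w, Ψ v q = Ψ w q → f v = f w := by
    intro v w h
    have := hf (Submodule.subset_span (hΨ.orbit_eq_iff.1 h))
    rwa [LinearMap.mem_ker, map_sub, sub_eq_zero] at this
  choose σ hσ using hΨ.surjective_orbit q
  have hFf : (fun x => f (σ x)) ∘ (fun v => Ψ v q) = f := by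
    funext v
    exact hfac _ _ (hσ _)
  have hF : Continuous fun x => f (σ x) := by
    rw [hquot.continuous_iff, hFf]
    exact f.continuous_of_finiteDimensional
  obtain ⟨C, hC⟩ := (isCompact_range hF).bddAbove
  obtain ⟨v, hv⟩ := LinearMap.surjective hf0 (C + 1)
  have : f v ≤ C := hC ⟨Ψ v q, congrFun hFf v⟩
  linarith

end IsLocallyTranslation

end

lemma isOpenQuotientMap_circleExp_two_pi :
    IsOpenQuotientMap fun t : ℝ => Circle.exp (2 * Real.pi * t) := by
  have hopen : IsOpenMap fun t : ℝ => Circle.exp (2 * Real.pi * t) :=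
    isLocalHomeomorph_circleExp.isOpenMap.comp
      (Homeomorph.mulLeft₀ (2 * Real.pi) Real.two_pi_pos.ne').isOpenMap
  refine ⟨fun z => ?_, by fun_prop, hopen⟩
  obtain ⟨t, rfl⟩ := Circle.exp_surjective z
  exact ⟨t / (2 * Real.pi), congrArg _ (by field_simp)⟩

lemma circleExp_two_pi_eq_iff (s t : ℝ) :
    Circle.exp (2 * Real.pi * s) = Circle.exp (2 * Real.pi * t) ↔ ∃ n : ℤ, (n : ℝ) = s - t := by
  rw [Circle.exp_eq_exp]
  refine exists_congr fun n => ?_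
  have := Real.two_pi_pos.ne'
  constructor
  · intro h
    have : 2 * Real.pi * (n - (s - t)) = 0 := by linear_combination -h
    simpa [Real.pi_ne_zero, sub_eq_zero] using this
  · intro h
    linear_combination (-2 * Real.pi) * h

/-- The quotient of the plane by a lattice is a torus. -/
lemma nonempty_homeomorph_torus_of_lattice {N : Type*} [TopologicalSpace N]
    {H : (Fin 2 → ℝ) → N} (hH : IsOpenQuotientMap H) (L : Submodule ℤ (Fin 2 → ℝ))
    [DiscreteTopology L] [IsZLattice ℝ L] (hL : ∀ v w, H v = H w ↔ v - w ∈ L) :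
    Nonempty (N ≃ₜ Circle × Circle) := by
  let b := IsZLattice.basis L
  let B : Basis (Fin 2) ℝ (Fin 2 → ℝ) := b.ofZLatticeBasis ℝ
  -- the coordinates with respect to a basis of the lattice, taken modulo `1`,
  -- have the fibres of `H`
  let e : (Fin 2 → ℝ) ≃ₜ ℝ × ℝ :=
    B.equivFun.toContinuousLinearEquiv.toHomeomorph.trans (Homeomorph.piFinTwo fun _ => ℝ)
  let G : (Fin 2 → ℝ) → Circle × Circle :=
    Prod.map (fun t : ℝ => Circle.exp (2 * Real.pi * t))
      (fun t : ℝ => Circle.exp (2 * Real.pi * t)) ∘ e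
  have hG : IsOpenQuotientMap G :=
    (isOpenQuotientMap_circleExp_two_pi.prodMap isOpenQuotientMap_circleExp_two_pi).comp
      e.isOpenQuotientMap
  have hGL : ∀ v w, G v = G w ↔ v - w ∈ L := by
    intro v w
    rw [← b.ofZLatticeBasis_span ℝ, Basis.mem_span_iff_repr_mem, Fin.forall_fin_two]
    simp only [G, Function.comp_apply, Prod.map, Prod.mk.injEq, circleExp_two_pi_eq_iff, map_sub]
    exact Iff.rfl
  have hGH : ∀ v w, H v = H w ↔ G v = G w := fun v w => (hL v w).trans (hGL v w).symm
  let HC : C(Fin 2 → ℝ, N) := ⟨H, hH.continuous⟩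
  let GC : C(Fin 2 → ℝ, Circle × Circle) := ⟨G, hG.continuous⟩
  have hHC : IsQuotientMap HC := hH.isQuotientMap
  have hGC : IsQuotientMap GC := hG.isQuotientMap
  exact ⟨hHC.homeomorph.symm.trans
    ((Homeomorph.Quotient.congrRight hGH).trans hGC.homeomorph)⟩

/-- A compact connected space on which the plane acts locally by translations is a torus. -/
theorem IsLocallyTranslation.nonempty_homeomorph_torus {N : Type*} [TopologicalSpace N]
    [ConnectedSpace N] [CompactSpace N] {Ψ : (Fin 2 → ℝ) → N → N} (hΨ : IsLocallyTranslation Ψ) :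
    Nonempty (N ≃ₜ Circle × Circle) := by
  obtain ⟨q⟩ := (inferInstance : Nonempty N)
  have := hΨ.discreteTopology_stabilizer q
  have : IsZLattice ℝ (hΨ.stabilizer q) := ⟨hΨ.span_stabilizer_eq_top q⟩
  exact nonempty_homeomorph_torus_of_lattice (hΨ.isOpenQuotientMap_orbit q) (hΨ.stabilizer q)
    fun v w => hΨ.orbit_eq_iff

/-! ### Actions on closed injectively immersed subspaces -/

/-- Let `N` be mapped continuously and injectively onto a closed subset of a compact Hausdorff
space `M`, equivariantly for an action on `N` that is transitive and locally by translations.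
Then `N` is compact. By Baire's theorem some compact piece of `N` contains the whole
preimage of a nonempty open set of `M`, and finitely many translates of that set cover
the image of `N`. -/
theorem IsLocallyTranslation.compactSpace_of_isClosed_range {V : Type*} [NormedAddCommGroup V]
    [NormedSpace ℝ V] [ProperSpace V] {N M : Type*} [TopologicalSpace N] [ConnectedSpace N]
    [TopologicalSpace M] [T2Space M] [CompactSpace M] {ι : N → M} (hι : Continuous ι)
    (hinj : Function.Injective ι) (hcl : IsClosed (range ι)) {Ψ : V → N → N}
    (hΨ : IsLocallyTranslation Ψ) {Φ : V → M → M} (hΦ : ∀ v, Continuous (Φ v))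
    (hΦΨ : ∀ v q, ι (Ψ v q) = Φ v (ι q)) : CompactSpace N := by
  obtain ⟨q₀⟩ := (inferInstance : Nonempty N)
  have : CompactSpace (range ι) := isCompact_iff_compactSpace.1 hcl.isCompact
  let K : ℕ → Set N := fun k => (fun v => Ψ v q₀) '' closedBall 0 k
  have hK : ∀ k, IsCompact (K k) := fun k =>
    (isCompact_closedBall (0 : V) k).image (hΨ.continuous_orbit q₀)
  have hKcover : ∀ q, ∃ k, q ∈ K k := fun q => by
    obtain ⟨v, rfl⟩ := hΨ.surjective_orbit q₀ q
    obtain ⟨k, hk⟩ := exists_nat_ge ‖v‖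
    exact ⟨k, v, by simpa using hk, rfl⟩
  have hKι : ∀ k, IsClosed (Subtype.val ⁻¹' (ι '' K k) : Set (range ι)) := fun k =>
    ((hK k).image hι).isClosed.preimage continuous_subtype_val
  have : Nonempty (range ι) := ⟨⟨ι q₀, q₀, rfl⟩⟩
  obtain ⟨k, ⟨x, hx⟩⟩ := nonempty_interior_of_iUnion_of_closed hKι (by
    refine eq_univ_of_forall ?_
    rintro ⟨_, q, rfl⟩
    obtain ⟨k, hk⟩ := hKcover q
    exact mem_iUnion.2 ⟨k, q, hk, rfl⟩)
  obtain ⟨U, hU, hUK⟩ := isOpen_induced_iff.1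
    (isOpen_interior (s := (Subtype.val ⁻¹' (ι '' K k) : Set (range ι))))
  have hUK' : ∀ q, ι q ∈ U → q ∈ K k := fun q hq => by
    have : (⟨ι q, q, rfl⟩ : range ι) ∈ interior (Subtype.val ⁻¹' (ι '' K k) : Set (range ι)) := by
      rw [← hUK]
      exact hq
    obtain ⟨q', hq', he⟩ := interior_subset this
    exact hinj he ▸ hq'
  obtain ⟨_, q₁, rfl⟩ := x
  have hq₁ : ι q₁ ∈ U := by
    rw [← hUK] at hx
    exact hx
  have hcover : range ι ⊆ ⋃ v : V, Φ v ⁻¹' U := by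
    rintro _ ⟨q, rfl⟩
    obtain ⟨v, hv⟩ := hΨ.surjective_orbit q q₁
    refine mem_iUnion.2 ⟨v, ?_⟩
    rw [mem_preimage, ← hΦΨ]
    rwa [show Ψ v q = q₁ from hv]
  obtain ⟨T, hT⟩ := hcl.isCompact.elim_finite_subcover _ (fun v => hU.preimage (hΦ v)) hcover
  refine ⟨?_⟩
  have : (univ : Set N) ⊆ ⋃ v ∈ T, Ψ (-v) '' K k := by
    intro q _
    obtain ⟨v, hv, hq⟩ := mem_iUnion₂.1 (hT ⟨q, rfl⟩)
    rw [mem_preimage, ← hΦΨ] at hq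
    exact mem_iUnion₂.2 ⟨v, hv, _, hUK' _ hq, hΨ.neg_cancel v q⟩
  exact (T.isCompact_biUnion fun v _ => (hK k).image (hΨ.continuous (-v))).of_isClosed_subset
    isClosed_univ this

/-! ### Flows of vector fields on compact manifolds -/

section

variable {E : Type*} [NormedAddCommGroup E] [NormedSpace ℝ E] [CompleteSpace E]
  {H : Type*} [TopologicalSpace H] {I : ModelWithCorners ℝ E H}
  {M : Type*} [TopologicalSpace M] [ChartedSpace H M] [IsManifold I 1 M]
  [BoundarylessManifold I M] {v : (x : M) → TangentSpace I x}

/-- A `C¹` vector field has, near every point, a local flow that is continuous in the initial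
point. -/
lemma exists_local_flow {x₀ : M}
    (hv : ContMDiffAt I I.tangent 1 (fun x => (⟨x, v x⟩ : TangentBundle I M)) x₀) :
    ∃ ε > 0, ∃ U ∈ 𝓝 x₀, ∃ Φ : ℝ → M → M,
      (∀ x ∈ U, Φ 0 x = x ∧ IsMIntegralCurveOn (fun t => Φ t x) v (Ioo (-ε) ε)) ∧
      ∀ t ∈ Ioo (-ε) ε, ContinuousOn (Φ t) U := by
  have hx : I.IsInteriorPoint x₀ := BoundarylessManifold.isInteriorPoint
  rw [contMDiffAt_iff] at hv
  obtain ⟨_, hv⟩ := hv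
  obtain ⟨ε, hε, a, r, L, K, hr, hpl⟩ := IsPicardLindelof.of_contDiffAt_one
    (hv.contDiffAt (range_mem_nhds_isInteriorPoint hx)).snd
  obtain ⟨α, hα, hαcont⟩ :=
    (hpl 0).exists_forall_mem_closedBall_eq_hasDerivWithinAt_continuousOn
  simp only [zero_sub, zero_add] at hα hαcont
  set z₀ := extChartAt I x₀ x₀ with hz₀
  -- shrink the domain so that the local flow in the chart stays in the target of the chart
  have hdom : closedBall z₀ r ×ˢ Icc (-ε) ε ∈ 𝓝 (z₀, (0 : ℝ)) :=
    prod_mem_nhds (closedBall_mem_nhds _ hr) (Icc_mem_nhds (by simpa using hε) hε)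
  have hα0 : α (z₀, 0) = z₀ := (hα z₀ (mem_closedBall_self hr.le)).1
  have hmem : ∀ᶠ p in 𝓝 (z₀, (0 : ℝ)), α p ∈ interior (extChartAt I x₀).target := by
    have := (hαcont.continuousAt hdom)
    rw [ContinuousAt, hα0] at this
    exact this (isOpen_interior.mem_nhds (I.isInteriorPoint_iff.mp hx))
  obtain ⟨W, hW, J, hJ, hWJ⟩ := mem_nhds_prod_iff.1 (hmem.and hdom)
  obtain ⟨δ, hδ, hδJ⟩ := Metric.mem_nhds_iff.1 hJ
  rw [Real.ball_eq_Ioo, zero_sub, zero_add] at hδJ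
  have hsub : ∀ z ∈ W, ∀ t ∈ Ioo (-δ) δ, α (z, t) ∈ interior (extChartAt I x₀).target ∧
      (z, t) ∈ closedBall z₀ (r : ℝ) ×ˢ Icc (-ε) ε := fun z hz t ht =>
    hWJ (mk_mem_prod hz (hδJ ht))
  have hzero : (0 : ℝ) ∈ Ioo (-δ) δ := ⟨by linarith, hδ⟩
  refine ⟨δ, hδ, (extChartAt I x₀).source ∩ extChartAt I x₀ ⁻¹' W, inter_mem
    (extChartAt_source_mem_nhds x₀) ((continuousAt_extChartAt x₀).preimage_mem_nhds hW),
    fun t x => (extChartAt I x₀).symm (α (extChartAt I x₀ x, t)), ?_, ?_⟩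
  · rintro x ⟨hxs, hxW⟩
    have hxball : extChartAt I x₀ x ∈ closedBall z₀ (r : ℝ) := (hsub _ hxW 0 hzero).2.1
    refine ⟨by simp only [(hα _ hxball).1, (extChartAt I x₀).left_inv hxs], fun t ht => ?_⟩
    have hIcc : ∀ s ∈ Ioo (-δ) δ, s ∈ Icc (-ε) ε := fun s hs => (hsub _ hxW s hs).2.2
    set xₜ : M := (extChartAt I x₀).symm (α (extChartAt I x₀ x, t)) with hxₜ
    have h : HasDerivAt (fun s => α (extChartAt I x₀ x, s))
        (fderivWithin ℝ (extChartAt I x₀ ∘ (extChartAt I xₜ).symm)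
        (range I) (extChartAt I xₜ xₜ) (v xₜ)) t :=
      ((hα _ hxball).2 t (hIcc t ht)).hasDerivAt
        (mem_of_superset (isOpen_Ioo.mem_nhds ht) hIcc)
    rw [← tangentCoordChange_def] at h
    have hf3 := (hsub _ hxW t ht).1
    have hf3' := interior_subset hf3
    have hft1 := mem_preimage.mp <|
      mem_of_mem_of_subset hf3' (extChartAt I x₀).target_subset_preimage_source
    have hft2 := mem_extChartAt_source (I := I) xₜ
    have hback : ∀ w : E,
        HasDerivAt (fun s => α (extChartAt I x₀ x, s)) (tangentCoordChange I xₜ x₀ xₜ w) t →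
        HasDerivAt ((extChartAt I xₜ ∘ (extChartAt I x₀).symm) ∘
          fun s => α (extChartAt I x₀ x, s)) w t := by
      intro w hw
      -- `w` is recovered from its expression in the chart at `x₀` by changing coordinates back
      rw [← tangentCoordChange_self (I := I) (x := xₜ) (z := xₜ) (v := w) hft2,
        ← tangentCoordChange_comp (x := x₀) ⟨⟨hft2, hft1⟩, hft2⟩]
      apply HasFDerivAt.comp_hasDerivAt _ _ hw
      apply HasFDerivWithinAt.hasFDerivAt (s := range I) _ <|
        mem_nhds_iff.mpr ⟨interior (extChartAt I x₀).target,
          subset_trans interior_subset (extChartAt_target_subset_range ..),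
          isOpen_interior, hf3⟩
      rw [← (extChartAt I x₀).right_inv hf3']
      exact hasFDerivWithinAt_tangentCoordChange ⟨hft1, hft2⟩
    apply HasMFDerivAt.hasMFDerivWithinAt
    refine ⟨ContinuousAt.comp (f := fun s => α (extChartAt I x₀ x, s))
      (continuousAt_extChartAt_symm'' hf3') h.continuousAt, ?_⟩
    exact (hback (v xₜ) h).hasFDerivAt.hasFDerivWithinAt
  · intro t ht
    refine (continuousOn_extChartAt_symm x₀).comp (hαcont.comp ?_ ?_) ?_
    · exact ((continuousOn_extChartAt x₀).mono inter_subset_left).prodMk continuousOn_const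
    · exact fun x hx => (hsub _ hx.2 t ht).2
    · exact fun x hx => interior_subset (hsub _ hx.2 t ht).1

variable [CompactSpace M]

/-- On a compact manifold the time of existence of the local flows can be chosen uniformly. -/
lemma exists_uniform_local_flow
    (hv : ContMDiff I I.tangent 1 (fun x => (⟨x, v x⟩ : TangentBundle I M))) :
    ∃ ε > 0, ∀ x₀ : M, ∃ U ∈ 𝓝 x₀, ∃ Φ : ℝ → M → M,
      (∀ x ∈ U, Φ 0 x = x ∧ IsMIntegralCurveOn (fun t => Φ t x) v (Ioo (-ε) ε)) ∧
      ∀ t ∈ Ioo (-ε) ε, ContinuousOn (Φ t) U := by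
  choose ε hε U hU Φ hΦ hΦc using fun x₀ => exists_local_flow (hv x₀)
  obtain ⟨T, hT⟩ := CompactSpace.elim_nhds_subcover (fun x => interior (U x))
    fun x => interior_mem_nhds.2 (hU x)
  obtain ⟨δ, hδ, hδε⟩ : ∃ δ > 0, ∀ x ∈ T, δ ≤ ε x := by
    rcases T.eq_empty_or_nonempty with rfl | hne
    · exact ⟨1, one_pos, by simp⟩
    · obtain ⟨x, -, hx⟩ := T.exists_min_image ε hne
      exact ⟨ε x, hε x, hx⟩
  refine ⟨δ, hδ, fun x₀ => ?_⟩
  obtain ⟨x, hxT, hx⟩ := mem_iUnion₂.1 (hT.symm ▸ mem_univ x₀ : x₀ ∈ ⋃ x ∈ T, interior (U x))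
  have hsub : Ioo (-δ) δ ⊆ Ioo (-ε x) (ε x) :=
    Ioo_subset_Ioo (neg_le_neg (hδε x hxT)) (hδε x hxT)
  exact ⟨U x, mem_interior_iff_mem_nhds.1 hx, Φ x,
    fun y hy => ⟨(hΦ x y hy).1, (hΦ x y hy).2.mono hsub⟩, fun t ht => hΦc x t (hsub ht)⟩

variable [T2Space M]

/-- `C¹` vector fields on a compact manifold are complete. -/
lemma exists_isMIntegralCurve_of_compactSpace
    (hv : ContMDiff I I.tangent 1 (fun x => (⟨x, v x⟩ : TangentBundle I M))) (x : M) :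
    ∃ γ : ℝ → M, γ 0 = x ∧ IsMIntegralCurve γ v := by
  obtain ⟨ε, hε, h⟩ := exists_uniform_local_flow hv
  refine exists_isMIntegralCurve_of_isMIntegralCurveOn hv hε (fun x => ?_) x
  obtain ⟨U, hU, Φ, hΦ, -⟩ := h x
  exact ⟨fun t => Φ t x, hΦ x (mem_of_mem_nhds hU)⟩

/-- The time-`t` maps of the flow of a `C¹` vector field on a compact manifold are continuous. -/
lemma continuous_flow
    (hv : ContMDiff I I.tangent 1 (fun x => (⟨x, v x⟩ : TangentBundle I M)))
    {γ : M → ℝ → M} (hγ0 : ∀ x, γ x 0 = x) (hγ : ∀ x, IsMIntegralCurve (γ x) v) (t : ℝ) :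
    Continuous fun x => γ x t := by
  obtain ⟨ε, hε, h⟩ := exists_uniform_local_flow hv
  have hsmall : ∀ t ∈ Ioo (-ε) ε, Continuous fun x => γ x t := by
    intro t ht
    refine continuous_iff_continuousAt.2 fun x₀ => ?_
    obtain ⟨U, hU, Φ, hΦ, hΦc⟩ := h x₀
    refine ((hΦc t ht).continuousAt hU).congr ?_
    filter_upwards [hU] with x hx
    exact isMIntegralCurveOn_Ioo_eqOn_of_contMDiff_boundaryless (t₀ := 0) ⟨by linarith, hε⟩ hv
      (hΦ x hx).2 ((hγ x).isMIntegralCurveOn _) ((hΦ x hx).1.trans (hγ0 x).symm) ht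
  have hadd : ∀ x s t, γ x (s + t) = γ (γ x t) s := fun x s t =>
    congrFun (isMIntegralCurve_Ioo_eq_of_contMDiff_boundaryless (t₀ := 0) hv
      ((hγ x).comp_add t) (hγ (γ x t)) (by simp [hγ0])) s
  -- a time-`t` map is an iterate of a time-`t / n` map
  have hiter : ∀ (n : ℕ) (s : ℝ), s ∈ Ioo (-ε) ε → Continuous fun x => γ x (n * s) := by
    intro n s hs
    induction n with
    | zero => simpa [hγ0] using continuous_id'
    | succ n ih =>
      have : (fun x => γ x ((n + 1 : ℕ) * s)) = (fun x => γ x s) ∘ fun x => γ x (n * s) := by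
        funext x
        rw [Function.comp_apply, ← hadd]
        congr 1
        push_cast
        ring
      rw [this]
      exact (hsmall s hs).comp ih
  obtain ⟨n, hn⟩ := exists_nat_gt (|t| / ε)
  have hn0 : (0 : ℝ) < n := (by positivity : 0 ≤ |t| / ε).trans_lt hn
  have hmem : t / n ∈ Ioo (-ε) ε := by
    rw [mem_Ioo, ← abs_lt, abs_div, abs_of_pos hn0, div_lt_iff₀ hn0]
    rwa [div_lt_iff₀ hε, mul_comm] at hn
  simpa [mul_div_cancel₀ t hn0.ne'] using hiter n (t / n) hmem

end

/-! ### Reeb vector fields -/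

section

variable {m : ℕ} {M : Type*} [TopologicalSpace M] [ChartedSpace (EuclideanSpace ℝ (Fin m)) M]
  [IsManifold (𝓡 m) ∞ M] {k : ℕ} {η : OneForm m M k}

/-- A `k`-contact form is an isomorphism from each fibre of its Reeb distribution onto `ℝᵏ`. -/
lemma OneForm.IsKContact.existsUnique_reeb (hη : η.IsKContact) (x : M) (v : Fin k → ℝ) :
    ∃! w : TangentSpace (𝓡 m) x, w ∈ η.reebDistribution x ∧ η x w = v := by
  let f : η.reebDistribution x →ₗ[ℝ] (Fin k → ℝ) :=
    (η x : TangentSpace (𝓡 m) x →ₗ[ℝ] (Fin k → ℝ)) ∘ₗ (η.reebDistribution x).subtype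
  have hf : Function.Injective f := by
    rw [← LinearMap.ker_eq_bot, LinearMap.ker_eq_bot']
    rintro ⟨w, hw⟩ h
    have : w ∈ η.ker x ⊓ η.kerD x := ⟨h, hw⟩
    rw [hη.ker_inf_kerD, Submodule.mem_bot] at this
    exact Subtype.ext this
  have : FiniteDimensional ℝ (TangentSpace (𝓡 m) x) :=
    inferInstanceAs (FiniteDimensional ℝ (EuclideanSpace ℝ (Fin m)))
  have hsurj : Function.Surjective f :=
    (LinearMap.injective_iff_surjective_of_finrank_eq_finrank (by
      rw [hη.kerD_isRegular.finrank_eq x]; simp)).1 hf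
  obtain ⟨⟨w, hw⟩, hwv⟩ := hsurj v
  refine ⟨w, ⟨hw, hwv⟩, fun w' hw' => ?_⟩
  exact congrArg Subtype.val (hf (a₁ := ⟨w', hw'.1⟩) (a₂ := ⟨w, hw⟩) (hw'.2.trans hwv.symm))

/-- The Reeb vector field of a `k`-contact form in the direction `v : ℝᵏ`: the section `R` of the
Reeb distribution with `η R = v`. -/
noncomputable def OneForm.IsKContact.reebField (hη : η.IsKContact) (v : Fin k → ℝ) (x : M) :
    TangentSpace (𝓡 m) x :=
  (hη.existsUnique_reeb x v).choose

lemma OneForm.IsKContact.reebField_mem (hη : η.IsKContact) (v : Fin k → ℝ) (x : M) :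
    hη.reebField v x ∈ η.reebDistribution x :=
  (hη.existsUnique_reeb x v).choose_spec.1.1

lemma OneForm.IsKContact.apply_reebField (hη : η.IsKContact) (v : Fin k → ℝ) (x : M) :
    η x (hη.reebField v x) = v :=
  (hη.existsUnique_reeb x v).choose_spec.1.2

lemma OneForm.IsKContact.eq_reebField (hη : η.IsKContact) {v : Fin k → ℝ} {x : M}
    {w : TangentSpace (𝓡 m) x} (hw : w ∈ η.reebDistribution x) (hwv : η x w = v) :
    w = hη.reebField v x :=
  (hη.existsUnique_reeb x v).choose_spec.2 w ⟨hw, hwv⟩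

lemma OneForm.IsKContact.reebField_smul (hη : η.IsKContact) (a : ℝ) (v : Fin k → ℝ) :
    hη.reebField (a • v) = a • hη.reebField v := by
  funext x
  refine (hη.eq_reebField ((η.reebDistribution x).smul_mem a (hη.reebField_mem v x)) ?_).symm
  rw [map_smul, hη.apply_reebField]

lemma OneForm.contMDiffAt_apply (η : OneForm m M k) {Y : ∀ x : M, TangentSpace (𝓡 m) x} {x₀ : M}
    (hY : ContMDiffAt (𝓡 m) (𝓡 m).tangent ∞ (fun x => (⟨x, Y x⟩ : TangentBundle (𝓡 m) M)) x₀) :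
    ContMDiffAt (𝓡 m) 𝓘(ℝ, Fin k → ℝ) ∞ (fun x => (η x (Y x) : Fin k → ℝ)) x₀ := by
  have h := (η.contMDiff x₀).clm_bundle_apply hY
  exact (Bundle.contMDiffAt_totalSpace.1 h).2

lemma OneForm.IsKContact.contMDiff_reebField (hη : η.IsKContact) (v : Fin k → ℝ) :
    ContMDiff (𝓡 m) (𝓡 m).tangent ∞
      (fun x => (⟨x, hη.reebField v x⟩ : TangentBundle (𝓡 m) M)) := by
  intro x₀
  obtain ⟨U, hU, hx₀, r, X, hX, hspan⟩ := hη.kerD_isRegular.isSmooth x₀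
  -- local sections `Y j` of the Reeb distribution with `η (Y j) = e_j` at `x₀`
  have hc : ∀ j : Fin k, ∃ c : Fin r → ℝ,
      ∑ i, c i • X i x₀ = hη.reebField (Pi.single j 1) x₀ := fun j => by
    have := hη.reebField_mem (Pi.single j 1) x₀
    rw [OneForm.reebDistribution, hspan x₀ hx₀] at this
    exact (Submodule.mem_span_range_iff_exists_fun ℝ).1 this
  choose c hc using hc
  let Y : Fin k → ∀ x : M, TangentSpace (𝓡 m) x := fun j x => ∑ i, c j i • X i x
  have hYsmooth : ∀ j, ContMDiffAt (𝓡 m) (𝓡 m).tangent ∞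
      (fun x => (⟨x, Y j x⟩ : TangentBundle (𝓡 m) M)) x₀ := fun j =>
    ContMDiffAt.sum_section fun i _ =>
      ContMDiffAt.const_smul_section (((hX i).contMDiffAt (hU.mem_nhds hx₀)))
  have hYmem : ∀ j, ∀ x ∈ U, Y j x ∈ η.reebDistribution x := fun j x hx => by
    rw [OneForm.reebDistribution, hspan x hx]
    exact Submodule.sum_mem _ fun i _ => Submodule.smul_mem _ _ (Submodule.subset_span ⟨i, rfl⟩)
  -- `A x` expresses `η (Y j)` at `x` in the standard basis; it is the identity at `x₀`, and
  -- `R_v = ∑ j, (A x)⁻¹ v j • Y j` where `A` is invertible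
  let A : M → (Fin k → ℝ) →L[ℝ] (Fin k → ℝ) := fun x =>
    ∑ j, (ContinuousLinearMap.proj (R := ℝ) (φ := fun _ : Fin k => ℝ) j).smulRight
      (η x (Y j x) : Fin k → ℝ)
  have hA : ContMDiffAt (𝓡 m) 𝓘(ℝ, (Fin k → ℝ) →L[ℝ] (Fin k → ℝ)) ∞ A x₀ := by
    refine ContMDiffAt.sum fun j _ => ?_
    exact ((ContinuousLinearMap.smulRightL ℝ (Fin k → ℝ) (Fin k → ℝ)
      (ContinuousLinearMap.proj j)).contDiff.contDiffAt).comp_contMDiffAt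
      (η.contMDiffAt_apply (hYsmooth j))
  have hA₀ : A x₀ = ContinuousLinearEquiv.refl ℝ (Fin k → ℝ) := by
    ext1 u
    simp only [A, Y, hc, hη.apply_reebField, sum_apply,
      ContinuousLinearMap.smulRight_apply, ContinuousLinearMap.proj_apply,
      ContinuousLinearEquiv.coe_coe, ContinuousLinearEquiv.refl_apply]
    exact (pi_eq_sum_univ' u).symm
  have hinv : ContMDiffAt (𝓡 m) 𝓘(ℝ, (Fin k → ℝ) →L[ℝ] (Fin k → ℝ)) ∞
      (fun x => (A x).inverse) x₀ := by
    have := contDiffAt_map_inverse (n := ∞) (ContinuousLinearEquiv.refl ℝ (Fin k → ℝ))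
    rw [← hA₀] at this
    exact this.comp_contMDiffAt hA
  have hcoef : ∀ j, ContMDiffAt (𝓡 m) 𝓘(ℝ, ℝ) ∞ (fun x => (A x).inverse v j) x₀ := fun j =>
    ((ContinuousLinearMap.proj (R := ℝ) (φ := fun _ : Fin k => ℝ) j ∘L
      ContinuousLinearMap.apply ℝ (Fin k → ℝ) v).contDiff.contDiffAt).comp_contMDiffAt hinv
  have hsum : ContMDiffAt (𝓡 m) (𝓡 m).tangent ∞
      (fun x => (⟨x, ∑ j, (A x).inverse v j • Y j x⟩ : TangentBundle (𝓡 m) M)) x₀ :=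
    ContMDiffAt.sum_section fun j _ => (hcoef j).smul_section (hYsmooth j)
  refine hsum.congr_of_eventuallyEq ?_
  have hunit : ∀ᶠ x in 𝓝 x₀, (A x).IsInvertible := by
    have := ContinuousLinearEquiv.nhds (ContinuousLinearEquiv.refl ℝ (Fin k → ℝ))
    rw [← hA₀] at this
    exact hA.continuousAt.eventually this
  filter_upwards [hU.mem_nhds hx₀, hunit] with x hx hxA
  refine congrArg (Bundle.TotalSpace.mk x) (hη.eq_reebField ?_ ?_).symm
  · exact Submodule.sum_mem _ fun j _ => Submodule.smul_mem _ _ (hYmem j x hx)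
  · have : A x ((A x).inverse v) = v := hxA.self_apply_inverse v
    rw [map_sum]
    simpa only [A, sum_apply, ContinuousLinearMap.smulRight_apply,
      ContinuousLinearMap.proj_apply, map_smul] using this

end

/-! ### Pullbacks of a one-form to a vector space -/

section

variable {m : ℕ} {M : Type*} [TopologicalSpace M] [ChartedSpace (EuclideanSpace ℝ (Fin m)) M]
  [IsManifold (𝓡 m) ∞ M] {k : ℕ}

/-- `η.inChart x` is the expression of `η` in the trivialisation of the bundle `Hom(TM, M × ℝᵏ)` at
`x`, hence inherits the regularity of `η`. -/
lemma OneForm.differentiableAt_inChart (η : OneForm m M k) (x : M) :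
    DifferentiableAt ℝ (η.inChart x) (extChartAt (𝓡 m) x x) := by
  have h := ((contMDiffAt_hom_bundle _).1 (η.contMDiff x)).2
  have hsymm : ContMDiffAt 𝓘(ℝ, EuclideanSpace ℝ (Fin m)) (𝓡 m) ∞ (extChartAt (𝓡 m) x).symm
      (extChartAt (𝓡 m) x x) :=
    (contMDiffOn_extChartAt_symm x).contMDiffAt (extChartAt_target_mem_nhds x)
  have hcomp := h.comp_of_eq hsymm (extChartAt_to_inv x)
  have hdiff := hcomp.contDiffAt.differentiableAt (by simp)
  refine hdiff.congr_of_eventuallyEq ?_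
  filter_upwards [extChartAt_target_mem_nhds (I := 𝓡 m) x] with y hy
  have hysrc := (extChartAt (𝓡 m) x).map_target hy
  have hsymmL := TangentBundle.symmL_trivializationAt (I := 𝓡 m) (x₀ := x)
    (x := (extChartAt (𝓡 m) x).symm y) (by simpa using hysrc)
  rw [ModelWithCorners.range_eq_univ, mfderivWithin_univ, (extChartAt (𝓡 m) x).right_inv hy]
    at hsymmL
  simp only [Function.comp_apply, ContinuousLinearMap.inCoordinates, OneForm.inChart]
  erw [hsymmL, Bundle.Trivial.continuousLinearMapAt_trivialization]
  rfl

/-- The pullback `g^*η` of a one-form to a vector space. -/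
noncomputable def OneForm.pullback (η : OneForm m M k) {E : Type*} [NormedAddCommGroup E]
    [NormedSpace ℝ E] (g : E → M) (z : E) : E →L[ℝ] (Fin k → ℝ) :=
  (η (g z)).comp (mfderiv 𝓘(ℝ, E) (𝓡 m) g z)

variable {E : Type*} [NormedAddCommGroup E] [NormedSpace ℝ E]

/-- Near `z`, the pullback of `η` by `g` is the pullback, by `g` read in the chart at `g z`, of the
expression of `η` in that chart. -/
lemma OneForm.pullback_eventuallyEq (η : OneForm m M k) {g : E → M} {z : E}
    (hg : ContMDiffAt 𝓘(ℝ, E) (𝓡 m) ∞ g z) :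
    η.pullback g =ᶠ[𝓝 z] fun z' => (η.inChart (g z) (extChartAt (𝓡 m) (g z) (g z'))).comp
      (fderiv ℝ (extChartAt (𝓡 m) (g z) ∘ g) z') := by
  set φ := extChartAt (𝓡 m) (g z) with hφ
  have hsrc : ∀ᶠ z' in 𝓝 z, g z' ∈ φ.source :=
    hg.continuousAt.preimage_mem_nhds (extChartAt_source_mem_nhds (g z))
  have hgd : ∀ᶠ z' in 𝓝 z, MDifferentiableAt 𝓘(ℝ, E) (𝓡 m) g z' := by
    have hg1 : ContMDiffAt 𝓘(ℝ, E) (𝓡 m) 1 g z := hg.of_le (by simp)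
    filter_upwards [(contMDiffAt_iff_contMDiffAt_nhds (by simp)).1 hg1] with z' hz'
    exact hz'.mdifferentiableAt (by simp)
  filter_upwards [hsrc, hsrc.eventually_nhds, hgd] with z' hz' hz'ev hgz'
  have hφd : MDifferentiableAt (𝓡 m) 𝓘(ℝ, EuclideanSpace ℝ (Fin m)) φ (g z') :=
    mdifferentiableAt_extChartAt (by simpa [hφ] using hz')
  have hφs : MDifferentiableAt 𝓘(ℝ, EuclideanSpace ℝ (Fin m)) (𝓡 m) φ.symm (φ (g z')) := by
    have := mdifferentiableWithinAt_extChartAt_symm (I := 𝓡 m) (φ.map_source hz')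
    rwa [ModelWithCorners.range_eq_univ, mdifferentiableWithinAt_univ] at this
  have hcomp : MDifferentiableAt 𝓘(ℝ, E) 𝓘(ℝ, EuclideanSpace ℝ (Fin m)) (φ ∘ g) z' :=
    hφd.comp z' hgz'
  have heq : g =ᶠ[𝓝 z'] φ.symm ∘ (φ ∘ g) := by
    filter_upwards [hz'ev] with y hy
    exact (φ.left_inv hy).symm
  have hchain := (mfderiv_comp z' hφs hcomp)
  -- `η` with its values at all points regarded as forms on the model space
  let η' : M → (EuclideanSpace ℝ (Fin m) →L[ℝ] (Fin k → ℝ)) := fun x => η x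
  have hη' : η' (φ.symm (φ (g z'))) = η' (g z') := by rw [φ.left_inv hz']
  ext1 u
  change η' (g z') (mfderiv 𝓘(ℝ, E) (𝓡 m) g z' u) = η' (φ.symm (φ (g z')))
    (mfderiv 𝓘(ℝ, EuclideanSpace ℝ (Fin m)) (𝓡 m) φ.symm (φ (g z')) (fderiv ℝ (φ ∘ g) z' u))
  rw [hη', heq.mfderiv_eq, hchain, mfderiv_eq_fderiv]
  rfl

/-- If the derivative of `g` at `z` takes values in `ker dη`, then `d(g^*η)` vanishes at `z`. The
chart of `M` in which `dη` is computed is the one at `g z`, so no comparison of `dη` in different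
charts is needed. -/
lemma OneForm.pullback_closed (η : OneForm m M k) {g : E → M} {z : E}
    (hg : ContMDiffAt 𝓘(ℝ, E) (𝓡 m) ∞ g z)
    (hker : ∀ u, mfderiv 𝓘(ℝ, E) (𝓡 m) g z u ∈ η.kerD (g z)) :
    DifferentiableAt ℝ (η.pullback g) z ∧
      ∀ u w, fderiv ℝ (η.pullback g) z u w = fderiv ℝ (η.pullback g) z w u := by
  have hev := η.pullback_eventuallyEq hg
  set φ := extChartAt (𝓡 m) (g z) with hφ
  have hφd : MDifferentiableAt (𝓡 m) 𝓘(ℝ, EuclideanSpace ℝ (Fin m)) φ (g z) :=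
    mdifferentiableAt_extChartAt (by simp)
  have hh : ContDiffAt ℝ ∞ (φ ∘ g) z :=
    (contMDiffAt_extChartAt.comp z hg).contDiffAt
  have hω := η.differentiableAt_inChart (g z)
  have hdiff : DifferentiableAt ℝ (η.pullback g) z := by
    refine DifferentiableAt.congr_of_eventuallyEq ?_ hev
    have h1 : DifferentiableAt ℝ (fun z' => η.inChart (g z) (φ (g z'))) z :=
      DifferentiableAt.comp (f := φ ∘ g) z hω (hh.differentiableAt (by simp))
    have h2 : DifferentiableAt ℝ (fderiv ℝ (φ ∘ g)) z :=
      (hh.fderiv_right (m := 1)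
        (one_add_one_eq_two.trans_le ENat.LEInfty.out)).differentiableAt (by simp)
    exact h1.clm_comp h2
  refine ⟨hdiff, fun u w => ?_⟩
  -- `J` and `J'` turn linear forms into alternating `1`-forms
  let J := ContinuousAlternatingMap.ofSubsingletonLIE (𝕜 := ℝ)
    (E := E) (F := Fin k → ℝ) (0 : Fin 1)
  let J' := ContinuousAlternatingMap.ofSubsingletonLIE (𝕜 := ℝ)
    (E := EuclideanSpace ℝ (Fin m)) (F := Fin k → ℝ) (0 : Fin 1)
  have hΩ : DifferentiableAt ℝ (fun y => J' (η.inChart (g z) y)) ((φ ∘ g) z) :=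
    J'.differentiable.differentiableAt.comp _ hω
  have hpull := extDeriv_pullback hΩ hh (by simpa using ENat.LEInfty.out)
  have hJ : (fun z' => J (η.pullback g z')) =ᶠ[𝓝 z] fun z' =>
      (J' (η.inChart (g z) ((φ ∘ g) z'))).compContinuousLinearMap (fderiv ℝ (φ ∘ g) z') := by
    filter_upwards [hev] with z' hz'
    rw [hz']
    rfl
  rw [← hJ.extDeriv_eq] at hpull
  have hJd : DifferentiableAt ℝ (fun z' => J (η.pullback g z')) z :=
    J.differentiable.differentiableAt.comp _ hdiff
  have hleft : extDeriv (fun z' => J (η.pullback g z')) z ![u, w] =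
      fderiv ℝ (η.pullback g) z u w - fderiv ℝ (η.pullback g) z w u := by
    have hfd : ∀ a b : E, fderiv ℝ (fun z' => η.pullback g z' a) z b =
        fderiv ℝ (η.pullback g) z b a := fun a b => by
      rw [fderiv_clm_apply hdiff (differentiableAt_const a)]
      simp
    rw [extDeriv_apply hJd, Fin.sum_univ_two]
    simp only [J, ContinuousAlternatingMap.ofSubsingletonLIE_apply,
      ContinuousAlternatingMap.ofSubsingleton_apply_apply, hfd, Fin.val_zero, Fin.val_one,
      pow_zero, pow_one, one_smul, neg_smul, ← sub_eq_add_neg]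
    rfl
  have hmf : ∀ u, fderiv ℝ (φ ∘ g) z u = mfderiv (𝓡 m) 𝓘(ℝ, EuclideanSpace ℝ (Fin m)) φ (g z)
      (mfderiv 𝓘(ℝ, E) (𝓡 m) g z u) := fun u => by
    rw [← mfderiv_eq_fderiv, mfderiv_comp z hφd (hg.mdifferentiableAt (by simp))]
    rfl
  have hright : extDeriv (fun y => J' (η.inChart (g z) y)) ((φ ∘ g) z)
      ![fderiv ℝ (φ ∘ g) z u, fderiv ℝ (φ ∘ g) z w] = 0 := by
    have := congrArg (fun f => f ![mfderiv 𝓘(ℝ, E) (𝓡 m) g z w]) (LinearMap.mem_ker.1 (hker u))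
    rw [hmf, hmf]
    simp only [AlternatingMap.curryLeft_apply_apply] at this
    refine Eq.trans (congrArg _ ?_) this
    funext i
    fin_cases i <;> rfl
  have := congrArg (fun f => f ![u, w]) hpull
  simp only [ContinuousAlternatingMap.compContinuousLinearMap_apply] at this
  rw [hleft] at this
  refine sub_eq_zero.1 (this.trans (Eq.trans (congrArg _ ?_) hright))
  funext i
  fin_cases i <;> rfl

end

/-! ### Straightening integral submanifolds of the Reeb distribution -/

section

variable {m : ℕ} {M : Type*} [TopologicalSpace M] [ChartedSpace (EuclideanSpace ℝ (Fin m)) M]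
  [IsManifold (𝓡 m) ∞ M] {k : ℕ}

/-- Coordinates in which a closed pulled back coframe is the standard one: they are
given by a local primitive of `g^*η`, which is a local diffeomorphism. -/
lemma OneForm.exists_straightening (η : OneForm m M k) {E : Type*} [NormedAddCommGroup E]
    [NormedSpace ℝ E] [FiniteDimensional ℝ E] {g : E → M} {W : Set E} {z₀ : E} (hW : W ∈ 𝓝 z₀)
    (hg : ∀ z ∈ W, ContMDiffAt 𝓘(ℝ, E) (𝓡 m) ∞ g z)
    (hker : ∀ z ∈ W, ∀ u, mfderiv 𝓘(ℝ, E) (𝓡 m) g z u ∈ η.kerD (g z))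
    (hbij : ∀ z ∈ W, Function.Bijective (η.pullback g z)) :
    ∃ F : OpenPartialHomeomorph E (Fin k → ℝ), z₀ ∈ F.source ∧ F.source ⊆ W ∧ F z₀ = 0 ∧
      ∀ p ∈ F.target, ∃ L : (Fin k → ℝ) →L[ℝ] E, HasFDerivAt F.symm L p ∧
        ∀ w, η.pullback g (F.symm p) (L w) = w := by
  obtain ⟨ρ, hρ, hρW⟩ := Metric.mem_nhds_iff.1 hW
  obtain ⟨f, hf⟩ : ∃ f, ∀ z ∈ ball z₀ ρ, HasFDerivAt f (η.pullback g z) z :=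
    (convex_ball z₀ ρ).exists_forall_hasFDerivAt_of_fderiv_symmetric isOpen_ball
    (fun z hz => (η.pullback_closed (hg z (hρW hz)) (hker z (hρW hz))).1.differentiableWithinAt)
    (fun z hz => (η.pullback_closed (hg z (hρW hz)) (hker z (hρW hz))).2)
  let e : ∀ z ∈ W, E ≃L[ℝ] (Fin k → ℝ) := fun z hz =>
    (LinearEquiv.ofBijective (η.pullback g z).toLinearMap (hbij z hz)).toContinuousLinearEquiv
  have he : ∀ z hz, (e z hz : E →L[ℝ] (Fin k → ℝ)) = η.pullback g z := fun z hz => by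
    ext1 u
    rfl
  let f₀ : E → (Fin k → ℝ) := fun z => f z - f z₀
  have hf₀ : ∀ z ∈ ball z₀ ρ, HasFDerivAt f₀ (η.pullback g z) z := fun z hz =>
    (hf z hz).sub_const _
  have hz₀ : z₀ ∈ ball z₀ ρ := mem_ball_self hρ
  have hstrict : HasStrictFDerivAt f₀ (e z₀ (hρW hz₀) : E →L[ℝ] (Fin k → ℝ)) z₀ := by
    rw [he _ (hρW hz₀)]
    refine hasStrictFDerivAt_of_hasFDerivAt_of_continuousAt
      (eventually_of_mem (isOpen_ball.mem_nhds hz₀) hf₀) ?_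
    exact (η.pullback_closed (hg z₀ (hρW hz₀)) (hker z₀ (hρW hz₀))).1.continuousAt
  let F := (hstrict.toOpenPartialHomeomorph f₀).restrOpen (ball z₀ ρ) isOpen_ball
  have hFsource : F.source ⊆ ball z₀ ρ := inter_subset_right
  refine ⟨F, ⟨hstrict.mem_toOpenPartialHomeomorph_source, hz₀⟩, hFsource.trans hρW,
    sub_self (f z₀), fun p hp => ?_⟩
  have hz : F.symm p ∈ ball z₀ ρ := hFsource (F.map_target hp)
  refine ⟨(e _ (hρW hz)).symm, F.hasFDerivAt_symm hp ?_, fun w => ?_⟩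
  · rw [he _ (hρW hz)]
    exact hf₀ _ hz
  · rw [← he _ (hρW hz)]
    exact (e _ (hρW hz)).apply_symm_apply w

variable {η : OneForm m M k}

lemma OneForm.IsKContact.contMDiff_one_reebField (hη : η.IsKContact) (v : Fin k → ℝ) :
    ContMDiff (𝓡 m) (𝓡 m).tangent 1
      (fun x => (⟨x, hη.reebField v x⟩ : TangentBundle (𝓡 m) M)) :=
  (hη.contMDiff_reebField v).of_le (by simp)

variable {n : ℕ} {N : Type*} [TopologicalSpace N]
  [ChartedSpace (EuclideanSpace ℝ (Fin n)) N] [IsManifold (𝓡 n) ∞ N] {ι : N → M}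

/-- Around each point of an integral submanifold of the Reeb distribution there are local
coordinates, with values in `ℝᵏ`, in which the integral curves of the Reeb vector fields are the
straight lines. -/
lemma IsIntegralSubmanifold.exists_reeb_coordinates (hη : η.IsKContact)
    (hι : IsIntegralSubmanifold (n := n) η.reebDistribution ι) (q : N) :
    ∃ r > 0, ∃ s : (Fin k → ℝ) → N, s 0 = q ∧ InjOn s (ball 0 r) ∧
      (∀ p ∈ ball (0 : Fin k → ℝ) r, map s (𝓝 p) = 𝓝 (s p)) ∧
      ∀ p w, IsMIntegralCurveOn (I := 𝓡 m) (fun t : ℝ => ι (s (p + t • w))) (hη.reebField w)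
        {t | p + t • w ∈ ball (0 : Fin k → ℝ) r} := by
  set ψ := extChartAt (𝓡 n) q with hψ
  let g : EuclideanSpace ℝ (Fin n) → M := ι ∘ ψ.symm
  have hψs : ∀ z ∈ ψ.target, ContMDiffAt 𝓘(ℝ, EuclideanSpace ℝ (Fin n)) (𝓡 n) ∞ ψ.symm z :=
    fun z hz => (contMDiffOn_extChartAt_symm q).contMDiffAt
      ((isOpen_extChartAt_target q).mem_nhds hz)
  have hg : ∀ z ∈ ψ.target, ContMDiffAt 𝓘(ℝ, EuclideanSpace ℝ (Fin n)) (𝓡 m) ∞ g z :=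
    fun z hz => (hι.contMDiff _).comp z (hψs z hz)
  have hchain : ∀ z ∈ ψ.target, ∀ u, mfderiv 𝓘(ℝ, EuclideanSpace ℝ (Fin n)) (𝓡 m) g z u =
      mfderiv (𝓡 n) (𝓡 m) ι (ψ.symm z)
        (mfderiv 𝓘(ℝ, EuclideanSpace ℝ (Fin n)) (𝓡 n) ψ.symm z u) := fun z hz u => by
    rw [mfderiv_comp z ((hι.contMDiff _).mdifferentiableAt (by simp))
      ((hψs z hz).mdifferentiableAt (by simp))]
    rfl
  have hinv : ∀ z ∈ ψ.target, Function.Bijective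
      (mfderiv 𝓘(ℝ, EuclideanSpace ℝ (Fin n)) (𝓡 n) ψ.symm z) := fun z hz => by
    have := isInvertible_mfderivWithin_extChartAt_symm (I := 𝓡 n) hz
    rw [ModelWithCorners.range_eq_univ, mfderivWithin_univ] at this
    exact this.bijective
  have hker : ∀ z ∈ ψ.target, ∀ u,
      mfderiv 𝓘(ℝ, EuclideanSpace ℝ (Fin n)) (𝓡 m) g z u ∈ η.kerD (g z) := fun z hz u => by
    rw [hchain z hz u]
    exact (hι.range_mfderiv (ψ.symm z)).le ⟨_, rfl⟩
  have hbij : ∀ z ∈ ψ.target, Function.Bijective (η.pullback g z) := fun z hz => by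
    constructor
    · refine (injective_iff_map_eq_zero _).2 fun u hu => ?_
      have hmem : mfderiv 𝓘(ℝ, EuclideanSpace ℝ (Fin n)) (𝓡 m) g z u ∈
          η.ker (g z) ⊓ η.kerD (g z) := ⟨hu, hker z hz u⟩
      rw [hη.ker_inf_kerD, Submodule.mem_bot, hchain z hz u] at hmem
      exact (hinv z hz).1 ((hι.injective_mfderiv _ (hmem.trans (map_zero _).symm)).trans
        (map_zero _).symm)
    · intro v
      have hmem : hη.reebField v (g z) ∈ LinearMap.range (mfderiv (𝓡 n) (𝓡 m) ι (ψ.symm z) :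
          TangentSpace (𝓡 n) (ψ.symm z) →ₗ[ℝ] TangentSpace (𝓡 m) (ι (ψ.symm z))) :=
        (hι.range_mfderiv (ψ.symm z)).symm ▸ hη.reebField_mem v (g z)
      obtain ⟨u', hu'⟩ := hmem
      obtain ⟨u, rfl⟩ := (hinv z hz).2 u'
      refine ⟨u, ?_⟩
      have : mfderiv 𝓘(ℝ, EuclideanSpace ℝ (Fin n)) (𝓡 m) g z u = hη.reebField v (g z) :=
        (hchain z hz u).trans hu'
      exact (congrArg (η (g z)) this).trans (hη.apply_reebField v (g z))
  obtain ⟨F, hz₀, hFW, hF0, hF⟩ := η.exists_straightening (z₀ := ψ q)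
    (extChartAt_target_mem_nhds q) hg hker hbij
  have h0 : (0 : Fin k → ℝ) ∈ F.target := hF0 ▸ F.map_source hz₀
  obtain ⟨r, hr, hrF⟩ := Metric.mem_nhds_iff.1 (F.open_target.mem_nhds h0)
  have htarget : ∀ p ∈ F.target, F.symm p ∈ ψ.target := fun p hp => hFW (F.map_target hp)
  refine ⟨r, hr, fun p => ψ.symm (F.symm p), ?_, ?_, ?_, ?_⟩
  · simp only
    rw [← hF0, F.left_inv hz₀, hψ, extChartAt_to_inv]
  · intro p hp p' hp' h
    exact F.symm.injOn (hrF hp) (hrF hp')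
      (ψ.symm.injOn (htarget _ (hrF hp)) (htarget _ (hrF hp')) h)
  · intro p hp
    have h1 := F.symm.map_nhds_eq (x := p) (hrF hp)
    have h2 := map_extChartAt_symm_nhdsWithin_range' (I := 𝓡 n) (x := q)
      (ψ.map_target (htarget p (hrF hp)))
    rw [ModelWithCorners.range_eq_univ, nhdsWithin_univ, ← hψ,
      ψ.right_inv (htarget p (hrF hp))] at h2
    rw [← h2, ← h1, Filter.map_map]
    rfl
  · intro p w t ht
    refine HasMFDerivAt.hasMFDerivWithinAt ?_
    obtain ⟨L, hL, hLw⟩ := hF (p + t • w) (hrF ht)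
    have hline : HasDerivAt (fun t : ℝ => p + t • w) w t := by
      simpa using ((hasDerivAt_id t).smul_const w).const_add p
    have hcurve : HasFDerivAt (fun t : ℝ => F.symm (p + t • w))
        ((1 : ℝ →L[ℝ] ℝ).smulRight (L w)) t :=
      (hL.comp_hasDerivAt t hline).hasFDerivAt
    have hz := htarget _ (hrF ht)
    have := ((hg _ hz).mdifferentiableAt (by simp)).hasMFDerivAt.comp t hcurve.hasMFDerivAt
    have hR : mfderiv 𝓘(ℝ, EuclideanSpace ℝ (Fin n)) (𝓡 m) g (F.symm (p + t • w)) (L w) =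
        hη.reebField w (g (F.symm (p + t • w))) :=
      hη.eq_reebField (hker _ hz _) (hLw w)
    refine this.congr_mfderiv ?_
    ext1
    change (mfderiv 𝓘(ℝ, EuclideanSpace ℝ (Fin n)) (𝓡 m) g (F.symm (p + t • w)))
      ((1 : ℝ) • L w) = (1 : ℝ) • hη.reebField w (g (F.symm (p + t • w)))
    rw [one_smul, one_smul]
    exact hR

end

/-! ### Reeb flows -/

section

variable {m : ℕ} {M : Type*} [TopologicalSpace M] [ChartedSpace (EuclideanSpace ℝ (Fin m)) M]
  [IsManifold (𝓡 m) ∞ M] [T2Space M] [CompactSpace M] {k : ℕ} {η : OneForm m M k}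

/-- The flow of the Reeb vector field in the direction `v`, up to time `1`. -/
noncomputable def OneForm.IsKContact.reebFlow (hη : η.IsKContact) (v : Fin k → ℝ) (x : M) : M :=
  (exists_isMIntegralCurve_of_compactSpace (hη.contMDiff_one_reebField v) x).choose 1

/-- The curve `t ↦ reebFlow (t • v) x` is the integral curve of the Reeb field in the direction
`v`, because Reeb fields depend linearly on the direction. -/
lemma OneForm.IsKContact.eq_reebFlow (hη : η.IsKContact) {v : Fin k → ℝ} {γ : ℝ → M}
    (hγ : IsMIntegralCurve γ (hη.reebField v)) (t : ℝ) : γ t = hη.reebFlow (t • v) (γ 0) := by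
  have hγt := hγ.comp_mul t
  rw [← hη.reebField_smul] at hγt
  have h := (exists_isMIntegralCurve_of_compactSpace
    (hη.contMDiff_one_reebField (t • v)) (γ 0)).choose_spec
  have := congrFun (isMIntegralCurve_Ioo_eq_of_contMDiff_boundaryless (t₀ := 0)
    (hη.contMDiff_one_reebField (t • v)) hγt h.2 (by simp [h.1])) 1
  simpa [OneForm.IsKContact.reebFlow] using this

lemma OneForm.IsKContact.exists_reebCurve (hη : η.IsKContact) (v : Fin k → ℝ) (x : M) :
    ∃ γ : ℝ → M, γ 0 = x ∧ IsMIntegralCurve γ (hη.reebField v) :=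
  exists_isMIntegralCurve_of_compactSpace (hη.contMDiff_one_reebField v) x

lemma OneForm.IsKContact.isMIntegralCurve_reebFlow (hη : η.IsKContact) (v : Fin k → ℝ) (x : M) :
    IsMIntegralCurve (fun t : ℝ => hη.reebFlow (t • v) x) (hη.reebField v) := by
  obtain ⟨γ, rfl, hγ⟩ := hη.exists_reebCurve v x
  convert! hγ using 2 with t
  exact (hη.eq_reebFlow hγ t).symm

lemma OneForm.IsKContact.reebFlow_zero (hη : η.IsKContact) (x : M) :
    hη.reebFlow 0 x = x := by
  obtain ⟨γ, rfl, hγ⟩ := hη.exists_reebCurve 0 x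
  simpa using (hη.eq_reebFlow hγ 0).symm

lemma OneForm.IsKContact.reebFlow_add_smul (hη : η.IsKContact) (v : Fin k → ℝ) (s t : ℝ) (x : M) :
    hη.reebFlow ((s + t) • v) x = hη.reebFlow (s • v) (hη.reebFlow (t • v) x) := by
  simpa using hη.eq_reebFlow ((hη.isMIntegralCurve_reebFlow v x).comp_add t) s

lemma OneForm.IsKContact.continuous_reebFlow (hη : η.IsKContact) (v : Fin k → ℝ) :
    Continuous (hη.reebFlow v) := by
  simpa using continuous_flow (hη.contMDiff_one_reebField v)
    (γ := fun x t => hη.reebFlow (t • v) x) (fun x => by simp [hη.reebFlow_zero])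
    (hη.isMIntegralCurve_reebFlow v) 1

variable {n : ℕ} {N : Type*} [TopologicalSpace N] [ChartedSpace (EuclideanSpace ℝ (Fin n)) N]
  [IsManifold (𝓡 n) ∞ N] {ι : N → M}

/-- In suitable coordinates of an integral submanifold the Reeb flows are translations. -/
lemma IsIntegralSubmanifold.exists_reebFlow_coordinates (hη : η.IsKContact)
    (hι : IsIntegralSubmanifold (n := n) η.reebDistribution ι) (q : N) :
    ∃ r > 0, ∃ s : (Fin k → ℝ) → N, s 0 = q ∧ InjOn s (ball 0 r) ∧
      (∀ p ∈ ball (0 : Fin k → ℝ) r, map s (𝓝 p) = 𝓝 (s p)) ∧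
      ∀ p w, p ∈ ball (0 : Fin k → ℝ) r → p + w ∈ ball (0 : Fin k → ℝ) r →
        hη.reebFlow w (ι (s p)) = ι (s (p + w)) := by
  obtain ⟨r, hr, s, hs0, hinj, hmap, hs⟩ := hι.exists_reeb_coordinates hη q
  refine ⟨r, hr, s, hs0, hinj, hmap, fun p w hp hpw => ?_⟩
  -- the segment from `p` to `p + w` extends slightly inside the ball
  set J : Set ℝ := {t | p + t • w ∈ ball (0 : Fin k → ℝ) r} with hJ
  have hJopen : IsOpen J := isOpen_ball.preimage (by fun_prop)
  have hJconv : Convex ℝ J := by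
    have hpre : J = AffineMap.lineMap (k := ℝ) p (p + w) ⁻¹' ball (0 : Fin k → ℝ) r := by
      ext t
      simp [hJ, AffineMap.lineMap_apply, add_comm]
    rw [hpre]
    exact (convex_ball (0 : Fin k → ℝ) r).affine_preimage _
  obtain ⟨a, ha0, ha⟩ : ∃ a < 0, a ∈ J := by
    have h0 : (0 : ℝ) ∈ J := by simpa [hJ] using hp
    obtain ⟨ε, hε, h⟩ := Metric.isOpen_iff.1 hJopen 0 h0
    exact ⟨-(ε / 2), by linarith, h (by simp [abs_of_pos hε]; linarith)⟩
  obtain ⟨b, hb1, hb⟩ : ∃ b > 1, b ∈ J := by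
    have h1 : (1 : ℝ) ∈ J := by simpa [hJ] using hpw
    obtain ⟨ε, hε, h⟩ := Metric.isOpen_iff.1 hJopen 1 h1
    exact ⟨1 + ε / 2, by linarith, h (by simp [abs_of_pos hε]; linarith)⟩
  have hsub : Ioo a b ⊆ J := Ioo_subset_Icc_self.trans (hJconv.ordConnected.out ha hb)
  have := isMIntegralCurveOn_Ioo_eqOn_of_contMDiff_boundaryless (t₀ := 0)
    ⟨ha0, by linarith⟩ (hη.contMDiff_one_reebField w)
    ((hη.isMIntegralCurve_reebFlow w (ι (s p))).isMIntegralCurveOn (Ioo a b))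
    ((hs p w).mono hsub) (by simp [hη.reebFlow_zero]) ⟨by linarith, hb1⟩
  simpa using this

/-- The Reeb flows preserve closed integral submanifolds: the times at which an orbit lies
in the submanifold form a set that is closed and open. -/
lemma IsIntegralSubmanifold.reebFlow_mem_range (hη : η.IsKContact)
    (hι : IsIntegralSubmanifold (n := n) η.reebDistribution ι) (hcl : IsClosed (range ι))
    (v : Fin k → ℝ) (q : N) : hη.reebFlow v (ι q) ∈ range ι := by
  let S : Set ℝ := {t | hη.reebFlow (t • v) (ι q) ∈ range ι}
  have hS : IsClopen S := by
    refine ⟨hcl.preimage (hη.isMIntegralCurve_reebFlow v (ι q)).continuous, ?_⟩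
    rw [Metric.isOpen_iff]
    rintro t ⟨q', hq'⟩
    obtain ⟨r, hr, s, hs0, -, -, hs⟩ := hι.exists_reebFlow_coordinates hη q'
    obtain ⟨ε, hε, hsmall⟩ := exists_norm_smul_lt v hr
    refine ⟨ε, hε, fun t' ht' => ⟨s ((t' - t) • v), ?_⟩⟩
    have := hs 0 ((t' - t) • v) (mem_ball_self hr)
      (by simpa using! hsmall (t' - t) (by simpa [Real.dist_eq] using ht'))
    rw [hs0, zero_add, hq', ← hη.reebFlow_add_smul, sub_add_cancel] at this
    exact this.symm
  have : (1 : ℝ) ∈ S := by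
    rw [hS.eq_univ ⟨0, q, by simp [hη.reebFlow_zero]⟩]
    exact mem_univ _
  simpa [S] using this

end

end KContact

theorem mainTheorem4 {m : ℕ} {M : Type*} [TopologicalSpace M]
    [ChartedSpace (EuclideanSpace ℝ (Fin m)) M] [IsManifold (𝓡 m) ∞ M] [T2Space M]
    [CompactSpace M] (η : KContact.OneForm m M 2) (hη : η.IsKContact)
    {n : ℕ} {N : Type*} [TopologicalSpace N] [ChartedSpace (EuclideanSpace ℝ (Fin n)) N]
    [IsManifold (𝓡 n) ∞ N] [ConnectedSpace N] (ι : N → M)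
    (hι : KContact.IsIntegralSubmanifold (n := n) η.reebDistribution ι) (hclosed : IsClosed (Set.range ι)) :
    Nonempty (N ≃ₜ Circle × Circle) := by
  choose Ψ hΨ using fun v q => hι.reebFlow_mem_range hη hclosed v q
  have hact : KContact.IsLocallyTranslation Ψ :=
    { zero := fun q => hι.injective (by rw [hΨ, hη.reebFlow_zero])
      add_smul := fun v s t q => hι.injective (by rw [hΨ, hΨ, hΨ, hη.reebFlow_add_smul])
      exists_chart := fun q => by
        obtain ⟨r, hr, s, hs0, hinj, hmap, hs⟩ := hι.exists_reebFlow_coordinates hη q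
        exact ⟨r, hr, s, hs0, hinj, hmap, fun p w hp hpw =>
          hι.injective (by rw [hΨ, hs p w hp hpw])⟩ }
  have := hact.compactSpace_of_isClosed_range hι.contMDiff.continuous hι.injective hclosed
    hη.continuous_reebFlow hΨ
  exact hact.nonempty_homeomorph_torus
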